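/- Let $N\ge 0$ be an integer and let $T$ be the dyadic tree of depth $N$, whose nodes are the dyadic intervals $[k2^{-n},(k+1)2^{-n}]\subset[0,1]$ with $0\le n\le N$ and $0\le k<2^n$. The nodes $\alpha$ of the bi-tree $T^2=T\times T$ are identified with the dyadic rectangles $R_\alpha\subset[0,1]^2$ that are products of two such intervals; $\alpha\le\beta$ means $R_\alpha\subset R_\beta$. The boundary $\partial T^2$ consists of the nodes $\omega$ for which $R_\omega$ is a dyadic square of side $2^{-N}$. A measure $\mu$ on $\partial T^2$ is a function $\mu:\partial T^2\to[0,\infty)$; put $\mu(E)=\sum_{\omega\in E}\mu(\omega)$ for $E\subset\partial T^2$, $\mu(R_\alpha)=\sum_{\omega\in\partial T^2,\ \omega\le\alpha}\mu(\omega)$ for $\alpha\in T^2$, and let $\mu|E$ be the measure equal to $\mu$ on $E$ and to $0$ on $\partial T^2\setminus E$. Define $$\mathcal E[\mu]=\sum_{\omega\in\partial T^2}\Big(\sum_{\beta\ge\omega}\mu(R_\beta)\Big)\mu(\omega)=\sum_{\alpha\in T^2}\mu(R_\alpha)^2,\qquad \mathcal E_E[\mu]=\sum_{\alpha\in T^2:\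 R_\alpha\subset U_E}\mu(R_\alpha)^2,\quad U_E=\bigcup_{\omega\in E}R_\omega .$$ **Theorem.** The bi-parameter Carleson condition implies the restricted energy condition, with an absolute constant. That is, there is an absolute constant $C>0$ (independent of $N$, $\mu$ and $K$) such that for every $N\ge0$, every measure $\mu$ on $\partial T^2$ and every $K\ge 0$: if $$\mathcal E_E[\mu]\le K\,\mu(E)\qquad\text{for all }E\subset\partial T^2,$$ then $$\mathcal E[\mu|E]\le C K\,\mu(E)\qquad\text{for all }E\subset\partial T^2 .$$ In particular, for $K=1$: if $\mathcal E_E[\mu]\le\mu(E)$ for all $E\subset\partial T^2$, then $\mathcal E[\mu|E]\le C\mu(E)$ for all $E\subset\partial T^2$. -/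

import Mathlib

namespace BiParameter

/-- The nodes of the finite dyadic tree `T` of depth `N`: a generation `n ∈ {0, …, N}` together
with a position `k ∈ {0, …, 2 ^ n - 1}`. -/
abbrev Tree (N : ℕ) : Type := Σ n : Fin (N + 1), Fin (2 ^ (n : ℕ))

/-- The dyadic subinterval `[k / 2 ^ n, (k + 1) / 2 ^ n]` of `[0, 1]` identified with the node
`(n, k)` of the tree. -/
def Tree.interval {N : ℕ} (a : Tree N) : Set ℝ :=
  Set.Icc (((a.2 : ℕ) : ℝ) / 2 ^ (a.1 : ℕ)) ((((a.2 : ℕ) : ℝ) + 1) / 2 ^ (a.1 : ℕ))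

/-- The nodes of the bi-tree `T² = T × T`. -/
abbrev BiTree (N : ℕ) : Type := Tree N × Tree N

/-- The dyadic rectangle `R_α ⊆ [0, 1]²` identified with the node `α` of the bi-tree. The order of
the bi-tree is inclusion of these rectangles: `α ≤ β` means `rect α ⊆ rect β`. -/
def rect {N : ℕ} (α : BiTree N) : Set (ℝ × ℝ) :=
  α.1.interval ×ˢ α.2.interval

/-- The boundary `∂T² = ∂T × ∂T`, where `∂T` consists of the `2 ^ N` nodes of generation `N`. -/
abbrev Boundary (N : ℕ) : Type := Fin (2 ^ N) × Fin (2 ^ N)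

/-- A boundary point as a node of the bi-tree; its rectangle is a dyadic square of
side `2 ^ (-N)`. -/
def leaf {N : ℕ} (ω : Boundary N) : BiTree N :=
  (⟨Fin.last N, ω.1⟩, ⟨Fin.last N, ω.2⟩)

/-- `U_E`, the union of the small squares `R_ω` with `ω ∈ E`. -/
def squareUnion {N : ℕ} (E : Finset (Boundary N)) : Set (ℝ × ℝ) :=
  ⋃ ω ∈ E, rect (leaf ω)

open Classical in
/-- `𝓡_E`, the collection of the dyadic rectangles (nodes of the bi-tree) contained in `U_E`. -/
noncomputable def rectsIn {N : ℕ} (E : Finset (Boundary N)) : Finset (BiTree N) :=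
  Finset.univ.filter fun α => rect α ⊆ squareUnion E

/-- `μ(E)` for `E ⊆ ∂T²`. A measure on the finite set `∂T²` is given by the masses `μ ω` of
its points. -/
def massOf {N : ℕ} (μ : Boundary N → ℝ) (E : Finset (Boundary N)) : ℝ :=
  ∑ ω ∈ E, μ ω

open Classical in
/-- `μ(R_α) = ∑_{ω ∈ ∂T², ω ≤ α} μ(ω)`, that is, `(𝕀* μ)(α)`. -/
noncomputable def rectMass {N : ℕ} (μ : Boundary N → ℝ) (α : BiTree N) : ℝ :=
  ∑ ω ∈ Finset.univ.filter (fun ω : Boundary N => rect (leaf ω) ⊆ rect α), μ ω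

/-- The restriction `μ|E`. -/
def restrict {N : ℕ} (μ : Boundary N → ℝ) (E : Finset (Boundary N)) : Boundary N → ℝ :=
  fun ω => if ω ∈ E then μ ω else 0

open Classical in
/-- The potential `𝕍^μ(α) = 𝕀(𝕀* μ)(α) = ∑_{β ≥ α} μ(R_β)`. -/
noncomputable def potential {N : ℕ} (μ : Boundary N → ℝ) (α : BiTree N) : ℝ :=
  ∑ β ∈ Finset.univ.filter (fun β : BiTree N => rect α ⊆ rect β), rectMass μ β

/-- The energy `𝓔[μ] = ∫ 𝕍^μ dμ`. -/
noncomputable def energy {N : ℕ} (μ : Boundary N → ℝ) : ℝ :=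
  ∑ ω, potential μ (leaf ω) * μ ω

/-- The energy is also `∑_{α ∈ T²} μ(R_α)²`. -/
theorem energy_eq_sum_sq {N : ℕ} (μ : Boundary N → ℝ) :
    energy μ = ∑ α : BiTree N, rectMass μ α ^ 2 := by
  classical
  unfold energy potential
  simp_rw [Finset.sum_mul, Finset.sum_filter]
  rw [Finset.sum_comm]
  refine Finset.sum_congr rfl fun α _ => ?_
  rw [← Finset.sum_filter, ← Finset.mul_sum, sq]
  congr 1

/-- The local energy `𝓔_E[μ] = ∑_{R ∈ 𝓡_E} μ(R)²`. -/
noncomputable def localEnergy {N : ℕ} (E : Finset (Boundary N)) (μ : Boundary N → ℝ) : ℝ :=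
  ∑ α ∈ rectsIn E, rectMass μ α ^ 2

/-- `μ` is a `K`-Carleson measure: `𝓔_E[μ] ≤ K μ(E)` for every `E ⊆ ∂T²`. -/
def IsCarleson {N : ℕ} (K : ℝ) (μ : Boundary N → ℝ) : Prop :=
  ∀ E : Finset (Boundary N), localEnergy E μ ≤ K * massOf μ E

/-- `μ` satisfies the restricted energy condition with constant `C`:
`𝓔[μ|E] ≤ C μ(E)` for every `E ⊆ ∂T²`. -/
def IsREC {N : ℕ} (C : ℝ) (μ : Boundary N → ℝ) : Prop :=
  ∀ E : Finset (Boundary N), energy (restrict μ E) ≤ C * massOf μ E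

end BiParameter

/-! Let `R` be the best restricted energy constant of `μ`, attained at a set `E`, and put `ν = μ|E`.
Rectangles are split by whether their `ν`-potential exceeds `δ = R/128`. High rectangles lie in
`U_F`, where `F` is the set of leaves of potential above `δ`, because the potential grows as
rectangles shrink. The Carleson condition bounds their energy by `K μ(F)`, and duality together with
the constant `R` itself gives `μ(F) ≤ 128² μ(E)`. Low rectangles carry at most half of the energy `R
μ(E)` (`sum_lowPart_mul_le`). Absorbing this half leaves `R ≤ 2·128² K`. The low bound is the
bi-parameter difficulty, since the maximum principle is only available on a single tree. Squaring
the potential of the truncated function produces a mixed term, the product of the two one-variable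
Hardy sums (`sq_hardy_le`). Its `ℓ²` norm is controlled by the one-parameter maximum principle used
in each variable separately (`sum_sq_hardyFst_mul_hardySnd_le`). -/

namespace BiParameter

/-! ### Hardy operators and the maximum principle on trees with chain ancestors. -/

section Hardy

open Classical

variable {T L : Type*} [Fintype T] [Fintype L] [Preorder T]

/-- The Hardy operator in the first variable. -/
noncomputable def hardyFst (g : T → T → ℝ) (x y : T) : ℝ :=
  ∑ a with x ≤ a, g a y

/-- The Hardy operator in the second variable. -/
noncomputable def hardySnd (g : T → T → ℝ) (x y : T) : ℝ :=
  ∑ b with y ≤ b, g x b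

/-- The bi-parameter Hardy operator. -/
noncomputable def hardy (g : T → T → ℝ) (x y : T) : ℝ :=
  ∑ a with x ≤ a, ∑ b with y ≤ b, g a b

/-- The adjoint of the Hardy operator, applied to a measure on pairs of leaves. -/
noncomputable def shadow (ℓ : L → T) (μ : L × L → ℝ) (a b : T) : ℝ :=
  ∑ ω with ℓ ω.1 ≤ a ∧ ℓ ω.2 ≤ b, μ ω

/-- Any two elements of a chain are ordered in at least one way; pairs ordered both ways, such as
the diagonal, are counted twice. -/
theorem sum_sum_le_of_chain {T : Type*} [Preorder T] {s : Finset T} (hs : ∀ a ∈ s, ∀ b ∈ s, a ≤ b ∨ b ≤ a)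
    {k : T → T → ℝ} (hk : ∀ a b, 0 ≤ k a b) :
    ∑ a ∈ s, ∑ b ∈ s, k a b ≤ ∑ a ∈ s, ∑ b ∈ s with a ≤ b, (k a b + k b a) := by
  have h1 : ∀ a ∈ s, ∀ b ∈ s,
      k a b ≤ (if a ≤ b then k a b else 0) + (if b ≤ a then k a b else 0) := by
    intro a ha b hb
    have := hk a b
    rcases hs a ha b hb with h | h <;> simp only [h, if_true] <;> split_ifs <;> linarith
  refine (Finset.sum_le_sum fun a ha => Finset.sum_le_sum fun b hb => h1 a ha b hb).trans_eq ?_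
  simp_rw [Finset.sum_filter, Finset.sum_add_distrib]
  rw [Finset.sum_comm (f := fun a b => if b ≤ a then k a b else 0), ← Finset.sum_add_distrib]
  refine Finset.sum_congr rfl fun a _ => ?_
  rw [← Finset.sum_add_distrib]
  refine Finset.sum_congr rfl fun b _ => ?_
  split_ifs <;> simp

theorem filter_filter_le {x a : T} (h : x ≤ a) :
    (Finset.univ.filter (x ≤ ·)).filter (a ≤ ·) = Finset.univ.filter (a ≤ ·) := by
  ext b
  simp only [Finset.mem_filter, Finset.mem_univ, true_and, and_iff_right_iff_imp]
  exact h.trans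

variable (T) in
/-- The ancestors of any node are pairwise comparable. -/
def ChainAncestors : Prop :=
  ∀ x a b : T, x ≤ a → x ≤ b → a ≤ b ∨ b ≤ a

theorem sq_sum_ancestors_le (hT : ChainAncestors T) {h : T → ℝ} (hh : ∀ a, 0 ≤ h a) (x : T) :
    (∑ a with x ≤ a, h a) ^ 2 ≤ 2 * ∑ a with x ≤ a, h a * ∑ b with a ≤ b, h b := by
  rw [sq, Finset.sum_mul_sum]
  refine (sum_sum_le_of_chain (fun a ha b hb => hT x a b (by simpa using ha) (by simpa using hb))
    fun a b => mul_nonneg (hh a) (hh b)).trans_eq ?_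
  rw [Finset.mul_sum]
  refine Finset.sum_congr rfl fun a ha => ?_
  rw [filter_filter_le (by simpa using ha), Finset.mul_sum, Finset.mul_sum]
  exact Finset.sum_congr rfl fun b _ => by ring

/-- Two nodes above `(x, y)` are either ordered the same way in both coordinates, giving the term `g
* hardy g`, or oppositely. In the second case both lie on the axes issuing from their common lower
corner, which gives `hardyFst g * hardySnd g`. -/
theorem sq_hardy_le (hT : ChainAncestors T) {g : T → T → ℝ} (hg : ∀ a b, 0 ≤ g a b) (x y : T) :
    hardy g x y ^ 2 ≤ 2 * hardy (fun a b => g a b * hardy g a b) x y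
      + 2 * hardy (fun a b => hardyFst g a b * hardySnd g a b) x y := by
  set s := Finset.univ.filter (x ≤ ·) with hs
  set t := Finset.univ.filter (y ≤ ·) with ht
  have cs : ∀ a ∈ s, ∀ b ∈ s, a ≤ b ∨ b ≤ a := fun a ha b hb =>
    hT x a b (by simpa [hs] using ha) (by simpa [hs] using hb)
  have ct : ∀ a ∈ t, ∀ b ∈ t, a ≤ b ∨ b ≤ a := fun a ha b hb =>
    hT y a b (by simpa [ht] using ha) (by simpa [ht] using hb)
  have e : hardy g x y ^ 2 = ∑ a ∈ s, ∑ c ∈ s, ∑ b ∈ t, ∑ d ∈ t, g a b * g c d := by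
    rw [sq, hardy, Finset.sum_mul_sum]
    simp_rw [Finset.sum_mul_sum]
    rfl
  rw [e]
  refine (sum_sum_le_of_chain cs fun a c => Finset.sum_nonneg fun b _ => Finset.sum_nonneg
    fun d _ => mul_nonneg (hg a b) (hg c d)).trans ?_
  have h2 : ∀ a c, ∑ b ∈ t, ∑ d ∈ t, g a b * g c d + ∑ b ∈ t, ∑ d ∈ t, g c b * g a d ≤
      ∑ b ∈ t, ∑ d ∈ t with b ≤ d, 2 * (g a b * g c d + g a d * g c b) := by
    intro a c
    simp_rw [← Finset.sum_add_distrib]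
    refine (sum_sum_le_of_chain ct fun b d => add_nonneg (mul_nonneg (hg _ _) (hg _ _))
      (mul_nonneg (hg _ _) (hg _ _))).trans_eq ?_
    exact Finset.sum_congr rfl fun b _ => Finset.sum_congr rfl fun d _ => by ring
  refine (Finset.sum_le_sum fun a _ => Finset.sum_le_sum fun c _ => h2 a c).trans_eq ?_
  simp only [hardy, ← hs, ← ht]
  rw [← mul_add, ← Finset.sum_add_distrib, Finset.mul_sum]
  refine Finset.sum_congr rfl fun a ha => ?_
  rw [filter_filter_le (by simpa [hs] using ha), Finset.sum_comm, ← Finset.sum_add_distrib,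
    Finset.mul_sum]
  refine Finset.sum_congr rfl fun b hb => ?_
  rw [filter_filter_le (by simpa [ht] using hb), hardyFst, hardySnd, Finset.sum_mul_sum,
    Finset.mul_sum, ← Finset.sum_add_distrib, Finset.mul_sum]
  refine Finset.sum_congr rfl fun c _ => ?_
  rw [Finset.mul_sum, ← Finset.sum_add_distrib, Finset.mul_sum]
  exact Finset.sum_congr rfl fun d _ => by ring

/-- The maximum principle on a tree: a sum of `h ≥ 0` along a chain of nodes at which the potential
of `h` is at most `δ` is itself at most `δ`. -/
theorem sum_chain_le (hT : ChainAncestors T) {h : T → ℝ} (hh : ∀ a, 0 ≤ h a) {δ : ℝ}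
    (hδ : 0 ≤ δ) {x : T} {s : Finset T} (hs : ∀ c ∈ s, x ≤ c ∧ ∑ b with c ≤ b, h b ≤ δ) : ∑ c ∈ s, h c ≤ δ := by
  rcases s.eq_empty_or_nonempty with rfl | hne
  · simpa using hδ
  -- All of `s` lies above its minimal element `m`, so its sum is part of the potential at `m`.
  obtain ⟨m, hm⟩ := s.exists_minimal hne
  refine le_trans (Finset.sum_le_sum_of_subset_of_nonneg ?_ fun b _ _ => hh b) (hs m hm.1).2
  intro c hc
  simp only [Finset.mem_filter, Finset.mem_univ, true_and]
  rcases hT x m c (hs m hm.1).1 (hs c hc).1 with h | h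
  · exact h
  · exact hm.2 hc h

/-- If `u` is the shadow of a measure `w` on leaves and `h` has potential at most `δ` at the nodes
of `P`, then `∑_{c ≤ a, c ∈ P} u(c) h(c) ≤ δ u(a)`. -/
theorem sum_descendants_le (hT : ChainAncestors T) {ℓ : L → T} {w : L → ℝ}
    (hw : ∀ i, 0 ≤ w i) {h : T → ℝ} (hh : ∀ a, 0 ≤ h a) {δ : ℝ} (hδ : 0 ≤ δ) (a : T) :
    ∑ c with c ≤ a ∧ ∑ b with c ≤ b, h b ≤ δ, (∑ i with ℓ i ≤ c, w i) * h c
      ≤ δ * ∑ i with ℓ i ≤ a, w i := by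
  set P := Finset.univ.filter fun c => c ≤ a ∧ ∑ b with c ≤ b, h b ≤ δ with hP
  have e : ∑ c ∈ P, (∑ i with ℓ i ≤ c, w i) * h c = ∑ i, w i * ∑ c ∈ P with ℓ i ≤ c, h c := by
    simp_rw [Finset.sum_mul, Finset.mul_sum, Finset.sum_filter]
    rw [Finset.sum_comm]
  rw [e, Finset.sum_filter, Finset.mul_sum]
  refine Finset.sum_le_sum fun i _ => ?_
  split_ifs with hi
  · rw [mul_comm δ]
    refine mul_le_mul_of_nonneg_left (sum_chain_le hT hh hδ (x := ℓ i) fun c hc => ?_) (hw i)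
    simp only [hP, Finset.mem_filter, Finset.mem_univ, true_and] at hc
    exact ⟨hc.2, hc.1.2⟩
  · rw [Finset.sum_eq_zero_iff_of_nonneg (fun c _ => hh c) |>.2, mul_zero, mul_zero]
    intro c hc
    simp only [hP, Finset.mem_filter, Finset.mem_univ, true_and] at hc
    exact absurd (hc.2.trans hc.1.1) hi

end Hardy

/-! ### The small energy estimate. -/

section Truncation

open Classical

variable {T L : Type*} [Fintype T] [Fintype L] [Preorder T]

/-- The part of `f` living on the nodes where its potential is at most `δ`. -/
noncomputable def lowPart (δ : ℝ) (f : T → T → ℝ) (a b : T) : ℝ :=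
  if hardy f a b ≤ δ then f a b else 0

theorem lowPart_nonneg {δ : ℝ} {f : T → T → ℝ} (hf : ∀ a b, 0 ≤ f a b) (a b : T) :
    0 ≤ lowPart δ f a b := by
  unfold lowPart; split_ifs <;> simp [hf]

theorem lowPart_le {δ : ℝ} {f : T → T → ℝ} (hf : ∀ a b, 0 ≤ f a b) (a b : T) :
    lowPart δ f a b ≤ f a b := by
  unfold lowPart; split_ifs <;> simp [hf]

theorem hardy_mono {g f : T → T → ℝ} (h : ∀ a b, g a b ≤ f a b) (x y : T) :
    hardy g x y ≤ hardy f x y :=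
  Finset.sum_le_sum fun a _ => Finset.sum_le_sum fun b _ => h a b

theorem hardy_nonneg {g : T → T → ℝ} (h : ∀ a b, 0 ≤ g a b) (x y : T) : 0 ≤ hardy g x y :=
  Finset.sum_nonneg fun a _ => Finset.sum_nonneg fun b _ => h a b

theorem hardyFst_nonneg {g : T → T → ℝ} (h : ∀ a b, 0 ≤ g a b) (x y : T) : 0 ≤ hardyFst g x y :=
  Finset.sum_nonneg fun a _ => h a y

theorem hardySnd_nonneg {g : T → T → ℝ} (h : ∀ a b, 0 ≤ g a b) (x y : T) : 0 ≤ hardySnd g x y :=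
  Finset.sum_nonneg fun b _ => h x b

theorem sum_hardyFst (g : T → T → ℝ) (x y : T) :
    ∑ b with y ≤ b, hardyFst g x b = hardy g x y :=
  Finset.sum_comm

theorem shadow_nonneg {T L : Type*} [Fintype L] [Preorder T] {ℓ : L → T} {μ : L × L → ℝ}
    (hμ : ∀ ω, 0 ≤ μ ω) (a b : T) : 0 ≤ shadow ℓ μ a b :=
  Finset.sum_nonneg fun ω _ => hμ ω

theorem shadow_eq_sum_snd {T L : Type*} [Fintype L] [Preorder T] (ℓ : L → T)
    (μ : L × L → ℝ) (a b : T) : shadow ℓ μ a b = ∑ j with ℓ j ≤ b, ∑ i with ℓ i ≤ a, μ (i, j) := by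
  simp only [shadow, Finset.sum_filter, Fintype.sum_prod_type_right]
  refine Finset.sum_congr rfl fun j _ => ?_
  by_cases h : ℓ j ≤ b <;> simp [h]

theorem shadow_eq_sum_fst {T L : Type*} [Fintype L] [Preorder T] (ℓ : L → T)
    (μ : L × L → ℝ) (a b : T) : shadow ℓ μ a b = ∑ i with ℓ i ≤ a, ∑ j with ℓ j ≤ b, μ (i, j) := by
  rw [shadow_eq_sum_snd, Finset.sum_comm]

/-- Duality between the Hardy operator and the shadow. -/
theorem sum_hardy_mul (ℓ : L → T) (μ : L × L → ℝ) (g : T → T → ℝ) :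
    ∑ ω, hardy g (ℓ ω.1) (ℓ ω.2) * μ ω = ∑ a, ∑ b, g a b * shadow ℓ μ a b := by
  have h : ∀ ω : L × L, hardy g (ℓ ω.1) (ℓ ω.2) * μ ω =
      ∑ a, ∑ b, if ℓ ω.1 ≤ a ∧ ℓ ω.2 ≤ b then g a b * μ ω else 0 := by
    intro ω
    simp only [hardy, Finset.sum_filter, Finset.sum_mul]
    refine Finset.sum_congr rfl fun a _ => ?_
    by_cases ha : ℓ ω.1 ≤ a <;> simp [ha, Finset.sum_mul]
  simp_rw [h]
  rw [Finset.sum_comm]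
  refine Finset.sum_congr rfl fun a _ => ?_
  rw [Finset.sum_comm]
  refine Finset.sum_congr rfl fun b _ => ?_
  rw [shadow, Finset.mul_sum, Finset.sum_filter]

/-- With the first coordinate `b` frozen, `hardyFst` of the shadow is a one-variable function whose
potential is the full bi-potential. Truncation at `δ` is thus exactly what the one-tree estimate
needs. -/
theorem sum_lowPart_mul_hardyFst_le (hT : ChainAncestors T) {ℓ : L → T} {μ : L × L → ℝ}
    (hμ : ∀ ω, 0 ≤ μ ω) {δ : ℝ} (hδ : 0 ≤ δ) (b a : T) :
    ∑ c with c ≤ a, lowPart δ (shadow ℓ μ) b c * hardyFst (lowPart δ (shadow ℓ μ)) b c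
      ≤ δ * shadow ℓ μ b a := by
  have hf := shadow_nonneg (ℓ := ℓ) hμ
  have key := sum_descendants_le hT (ℓ := ℓ) (w := fun j => ∑ i with ℓ i ≤ b, μ (i, j))
    (fun j => Finset.sum_nonneg fun i _ => hμ _) (h := hardyFst (shadow ℓ μ) b)
    (hardyFst_nonneg hf b) hδ a
  simp only [← shadow_eq_sum_snd, sum_hardyFst] at key
  refine le_trans ?_ key
  rw [← Finset.filter_filter, Finset.sum_filter (fun c => hardy (shadow ℓ μ) b c ≤ δ)]
  refine Finset.sum_le_sum fun c _ => ?_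
  by_cases h : hardy (shadow ℓ μ) b c ≤ δ
  · rw [if_pos h, lowPart, if_pos h]
    exact mul_le_mul_of_nonneg_left (Finset.sum_le_sum fun _ _ => lowPart_le hf _ _) (hf _ _)
  · simp [lowPart, h]

theorem sum_lowPart_mul_hardySnd_le (hT : ChainAncestors T) {ℓ : L → T} {μ : L × L → ℝ}
    (hμ : ∀ ω, 0 ≤ μ ω) {δ : ℝ} (hδ : 0 ≤ δ) (b a : T) :
    ∑ c with c ≤ b, lowPart δ (shadow ℓ μ) c a * hardySnd (lowPart δ (shadow ℓ μ)) c a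
      ≤ δ * shadow ℓ μ b a := by
  have hf := shadow_nonneg (ℓ := ℓ) hμ
  have key := sum_descendants_le hT (ℓ := ℓ) (w := fun i => ∑ j with ℓ j ≤ a, μ (i, j))
    (fun i => Finset.sum_nonneg fun j _ => hμ _) (h := fun c => hardySnd (shadow ℓ μ) c a)
    (fun c => hardySnd_nonneg hf c a) hδ b
  simp only [← shadow_eq_sum_fst] at key
  change ∑ c with c ≤ b ∧ hardy (shadow ℓ μ) c a ≤ δ,
    shadow ℓ μ c a * hardySnd (shadow ℓ μ) c a ≤ _ at key
  refine le_trans ?_ key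
  rw [← Finset.filter_filter, Finset.sum_filter (fun c => hardy (shadow ℓ μ) c a ≤ δ)]
  refine Finset.sum_le_sum fun c _ => ?_
  by_cases h : hardy (shadow ℓ μ) c a ≤ δ
  · rw [if_pos h, lowPart, if_pos h]
    exact mul_le_mul_of_nonneg_left (Finset.sum_le_sum fun _ _ => lowPart_le hf _ _) (hf _ _)
  · simp [lowPart, h]

/-- Expanding each square along its own chain and exchanging sums factors the total, at each corner
`(a, b)`, into two one-variable sums over descendants, each at most `δ * shadow ℓ μ a b`. -/
theorem sum_sq_hardyFst_mul_hardySnd_le (hT : ChainAncestors T) {ℓ : L → T} {μ : L × L → ℝ}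
    (hμ : ∀ ω, 0 ≤ μ ω) {δ : ℝ} (hδ : 0 ≤ δ) :
    ∑ x, ∑ y, (hardyFst (lowPart δ (shadow ℓ μ)) x y * hardySnd (lowPart δ (shadow ℓ μ)) x y) ^ 2
      ≤ 4 * δ ^ 2 * ∑ a, ∑ b, shadow ℓ μ a b ^ 2 := by
  have hf := shadow_nonneg (ℓ := ℓ) hμ
  set g := lowPart δ (shadow ℓ μ) with hgdef
  have hg : ∀ a b, 0 ≤ g a b := lowPart_nonneg hf
  have h1 : ∀ x y, (hardyFst g x y * hardySnd g x y) ^ 2 ≤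
      ∑ a with x ≤ a, ∑ b with y ≤ b,
        4 * ((g a y * hardyFst g a y) * (g x b * hardySnd g x b)) := by
    intro x y
    rw [mul_pow]
    refine (mul_le_mul (sq_sum_ancestors_le hT (fun a => hg a y) x)
      (sq_sum_ancestors_le hT (fun b => hg x b) y) (sq_nonneg _) ?_).trans_eq ?_
    · exact mul_nonneg zero_le_two (Finset.sum_nonneg fun a _ => mul_nonneg (hg _ _)
        (hardyFst_nonneg hg a y))
    · rw [mul_mul_mul_comm, Finset.sum_mul_sum, Finset.mul_sum]
      refine Finset.sum_congr rfl fun a _ => ?_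
      rw [Finset.mul_sum]
      refine Finset.sum_congr rfl fun b _ => ?_
      rw [hardyFst, hardySnd]
      ring
  have h2 : ∀ a b, (∑ y with y ≤ b, g a y * hardyFst g a y) *
      (∑ x with x ≤ a, g x b * hardySnd g x b) ≤ δ ^ 2 * shadow ℓ μ a b ^ 2 := by
    intro a b
    refine (mul_le_mul (sum_lowPart_mul_hardyFst_le hT hμ hδ a b)
      (sum_lowPart_mul_hardySnd_le hT hμ hδ a b) ?_ ?_).trans_eq (by ring)
    · exact Finset.sum_nonneg fun x _ => mul_nonneg (hg _ _) (hardySnd_nonneg hg _ _)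
    · exact mul_nonneg hδ (hf _ _)
  calc _ ≤ ∑ x, ∑ y, ∑ a with x ≤ a, ∑ b with y ≤ b,
        4 * ((g a y * hardyFst g a y) * (g x b * hardySnd g x b)) :=
        Finset.sum_le_sum fun x _ => Finset.sum_le_sum fun y _ => h1 x y
    _ = ∑ x, ∑ a with x ≤ a, ∑ y, ∑ b with y ≤ b,
        4 * ((g a y * hardyFst g a y) * (g x b * hardySnd g x b)) :=
        Finset.sum_congr rfl fun x _ => Finset.sum_comm
    _ = ∑ x, ∑ a with x ≤ a, ∑ b, ∑ y with y ≤ b,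
        4 * ((g a y * hardyFst g a y) * (g x b * hardySnd g x b)) := by
        refine Finset.sum_congr rfl fun x _ => Finset.sum_congr rfl fun a _ => ?_
        simp_rw [Finset.sum_filter]
        exact Finset.sum_comm
    _ = ∑ a, ∑ x with x ≤ a, ∑ b, ∑ y with y ≤ b,
        4 * ((g a y * hardyFst g a y) * (g x b * hardySnd g x b)) := by
        simp_rw [Finset.sum_filter (fun x => x ≤ _), Finset.sum_filter (fun a => _ ≤ a)]
        exact Finset.sum_comm
    _ = ∑ a, ∑ b, 4 * ((∑ y with y ≤ b, g a y * hardyFst g a y) *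
          (∑ x with x ≤ a, g x b * hardySnd g x b)) := by
        refine Finset.sum_congr rfl fun a _ => ?_
        rw [Finset.sum_comm]
        refine Finset.sum_congr rfl fun b _ => ?_
        rw [Finset.sum_mul_sum, Finset.sum_comm, Finset.mul_sum]
        exact Finset.sum_congr rfl fun y _ => (Finset.mul_sum _ _ _).symm
    _ ≤ ∑ a, ∑ b, 4 * (δ ^ 2 * shadow ℓ μ a b ^ 2) :=
        Finset.sum_le_sum fun a _ => Finset.sum_le_sum fun b _ =>
          mul_le_mul_of_nonneg_left (h2 a b) (by norm_num)
    _ = _ := by simp_rw [Finset.mul_sum, mul_assoc]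

theorem sum_sum_mul_sq_le {T : Type*} [Fintype T] (p q : T → T → ℝ) :
    (∑ a, ∑ b, p a b * q a b) ^ 2 ≤ (∑ a, ∑ b, p a b ^ 2) * ∑ a, ∑ b, q a b ^ 2 := by
  simp_rw [← Fintype.sum_prod_type']
  exact Finset.sum_mul_sq_le_sq_mul_sq _ _ _

/-- Small energy estimate: the energy carried by the nodes of potential at most `δ`. -/
theorem sum_lowPart_mul_le (hT : ChainAncestors T) {ℓ : L → T} {μ : L × L → ℝ}
    (hμ : ∀ ω, 0 ≤ μ ω) {δ lam : ℝ} (hδ : 0 ≤ δ) (hlam : 0 < lam) (hδlam : 4 * δ ≤ lam) :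
    ∑ a, ∑ b, lowPart δ (shadow ℓ μ) a b * shadow ℓ μ a b
      ≤ lam * ∑ ω, μ ω + 8 * (δ / lam) * ∑ a, ∑ b, shadow ℓ μ a b ^ 2 := by
  have hf := shadow_nonneg (ℓ := ℓ) hμ
  set f := shadow ℓ μ with hfdef
  set g := lowPart δ f with hgdef
  have hg : ∀ a b, 0 ≤ g a b := lowPart_nonneg hf
  set p : T → T → ℝ := fun a b => hardyFst g a b * hardySnd g a b with hp
  have hp0 : ∀ a b, 0 ≤ p a b := fun a b =>
    mul_nonneg (hardyFst_nonneg hg a b) (hardySnd_nonneg hg a b)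
  -- Where `hardy g` is at least `lam ≥ 4δ`, the term `2δ * hardy g` is at most half of its square
  -- and is absorbed.
  have hpt : ∀ x y, hardy g x y ≤ lam + 4 / lam * hardy p x y := by
    intro x y
    have h1 := sq_hardy_le hT hg x y
    have h2 : hardy (fun a b => g a b * hardy g a b) x y ≤ δ * hardy g x y := by
      have e : δ * hardy g x y = hardy (fun a b => δ * g a b) x y := by
        simp only [hardy, Finset.mul_sum]
      rw [e]
      refine hardy_mono (fun a b => ?_) x y
      by_cases h : hardy f a b ≤ δ
      · rw [mul_comm]
        exact mul_le_mul_of_nonneg_right ((hardy_mono (lowPart_le hf) a b).trans h) (hg a b)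
      · simp [hgdef, lowPart, h]
    have h3 := hardy_nonneg hp0 x y
    have h4 : (0 : ℝ) ≤ 4 / lam * hardy p x y := by positivity
    rcases le_total (hardy g x y) lam with h | h
    · linarith
    · suffices hardy g x y ≤ 4 / lam * hardy p x y by linarith
      rw [div_mul_eq_mul_div, le_div_iff₀ hlam]
      have h0 := hardy_nonneg hg x y
      nlinarith
  have hE : 0 ≤ ∑ a, ∑ b, f a b ^ 2 :=
    Finset.sum_nonneg fun a _ => Finset.sum_nonneg fun b _ => sq_nonneg _
  have hpf : ∑ a, ∑ b, p a b * f a b ≤ 2 * δ * ∑ a, ∑ b, f a b ^ 2 := by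
    refine (le_abs_self _).trans
      (abs_le_of_sq_le_sq ((sum_sum_mul_sq_le p f).trans ?_) (by positivity))
    refine (mul_le_mul_of_nonneg_right (sum_sq_hardyFst_mul_hardySnd_le hT hμ hδ) hE).trans_eq ?_
    ring
  rw [← sum_hardy_mul]
  calc _ ≤ ∑ ω : L × L, (lam + 4 / lam * hardy p (ℓ ω.1) (ℓ ω.2)) * μ ω :=
        Finset.sum_le_sum fun ω _ => mul_le_mul_of_nonneg_right (hpt _ _) (hμ ω)
    _ = lam * ∑ ω, μ ω + 4 / lam * ∑ a, ∑ b, p a b * f a b := by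
        rw [← sum_hardy_mul, Finset.mul_sum, Finset.mul_sum, ← Finset.sum_add_distrib]
        exact Finset.sum_congr rfl fun ω _ => by ring
    _ ≤ lam * ∑ ω, μ ω + 4 / lam * (2 * δ * ∑ a, ∑ b, f a b ^ 2) := by gcongr
    _ = _ := by ring

end Truncation

/-! ### Dyadic intervals as a tree with chain ancestors. -/

section Dyadic

variable {N : ℕ}

/-- The order of the tree is inclusion of dyadic intervals. -/
instance treeLE : LE (Tree N) :=
  ⟨fun a b => a.interval ⊆ b.interval⟩

instance treePreorder : Preorder (Tree N) where
  lt a b := a ≤ b ∧ ¬ b ≤ a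
  le_refl a := Set.Subset.refl a.interval
  le_trans _ _ _ h₁ h₂ := Set.Subset.trans h₁ h₂

theorem Tree.le_iff {a b : Tree N} : a ≤ b ↔ a.interval ⊆ b.interval :=
  Iff.rfl

theorem Tree.left_lt_right (a : Tree N) :
    ((a.2 : ℕ) : ℝ) / 2 ^ (a.1 : ℕ) < (((a.2 : ℕ) : ℝ) + 1) / 2 ^ (a.1 : ℕ) := by
  gcongr
  linarith

theorem Tree.interval_nonempty (a : Tree N) : a.interval.Nonempty :=
  Set.nonempty_Icc.2 a.left_lt_right.le

/-- Two dyadic intervals with a common interior point are nested. -/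
theorem Tree.le_of_mem_interior {a b : Tree N} (hab : (a.1 : ℕ) ≤ b.1) {p : ℝ}
    (ha₁ : ((a.2 : ℕ) : ℝ) / 2 ^ (a.1 : ℕ) < p) (ha₂ : p < (((a.2 : ℕ) : ℝ) + 1) / 2 ^ (a.1 : ℕ))
    (hb₁ : ((b.2 : ℕ) : ℝ) / 2 ^ (b.1 : ℕ) < p)
    (hb₂ : p < (((b.2 : ℕ) : ℝ) + 1) / 2 ^ (b.1 : ℕ)) : b ≤ a := by
  obtain ⟨⟨m, hm⟩, ⟨l, hl⟩⟩ := a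
  obtain ⟨⟨n, hn⟩, ⟨k, hk⟩⟩ := b
  simp only at *
  obtain ⟨d, rfl⟩ := Nat.exists_eq_add_of_le hab
  have h2m : (0 : ℝ) < 2 ^ m := by positivity
  have h2n : (0 : ℝ) < 2 ^ (m + d) := by positivity
  -- Strictness at an interior point makes integrality give `l * 2 ^ d ≤ k`; closed intervals
  -- meeting only at an endpoint would not be nested.
  have h1 : l * 2 ^ d < k + 1 := by
    have := ha₁.trans hb₂
    rw [div_lt_div_iff₀ h2m h2n, pow_add, ← mul_assoc, mul_right_comm,
      mul_lt_mul_iff_left₀ h2m] at this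
    exact_mod_cast this
  have h2 : k < (l + 1) * 2 ^ d := by
    have := hb₁.trans ha₂
    rw [div_lt_div_iff₀ h2n h2m, pow_add, ← mul_assoc, mul_right_comm,
      mul_lt_mul_iff_left₀ h2m] at this
    exact_mod_cast this
  refine Set.Icc_subset_Icc ?_ ?_ <;> simp only
  · rw [div_le_div_iff₀ h2m h2n, pow_add, ← mul_assoc, mul_right_comm, mul_le_mul_iff_left₀ h2m]
    exact_mod_cast Nat.lt_succ_iff.1 h1
  · rw [div_le_div_iff₀ h2n h2m, pow_add, ← mul_assoc, mul_right_comm _ (2 ^ m),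
      mul_le_mul_iff_left₀ h2m]
    exact_mod_cast h2

theorem Tree.chainAncestors : ChainAncestors (Tree N) := by
  intro x a b ha hb
  obtain ⟨p, hp₁, hp₂⟩ := exists_between x.left_lt_right
  have ha' := (Set.Icc_subset_Icc_iff x.left_lt_right.le).1 ha
  have hb' := (Set.Icc_subset_Icc_iff x.left_lt_right.le).1 hb
  rcases le_total (a.1 : ℕ) b.1 with h | h
  · exact Or.inr (Tree.le_of_mem_interior h (ha'.1.trans_lt hp₁) (hp₂.trans_le ha'.2)
      (hb'.1.trans_lt hp₁) (hp₂.trans_le hb'.2))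
  · exact Or.inl (Tree.le_of_mem_interior h (hb'.1.trans_lt hp₁) (hp₂.trans_le hb'.2)
      (ha'.1.trans_lt hp₁) (hp₂.trans_le ha'.2))

/-- The leaf of the tree with position `i`. -/
def leafNode (i : Fin (2 ^ N)) : Tree N :=
  ⟨Fin.last N, i⟩

/-- A dyadic interval is covered by the leaf intervals that it contains. -/
theorem Tree.exists_leafNode (a : Tree N) {t : ℝ} (ht : t ∈ a.interval) :
    ∃ i : Fin (2 ^ N), leafNode i ≤ a ∧ t ∈ (leafNode i).interval := by
  obtain ⟨⟨m, hm⟩, ⟨l, hl⟩⟩ := a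
  obtain ⟨d, rfl⟩ := Nat.exists_eq_add_of_le (Nat.lt_succ_iff.1 hm)
  simp only [Tree.interval, Set.mem_Icc] at ht
  obtain ⟨ht₁, ht₂⟩ := ht
  have h2m : (0 : ℝ) < 2 ^ m := by positivity
  have h2d : (0 : ℝ) < 2 ^ d := by positivity
  have h2n : (0 : ℝ) < 2 ^ (m + d) := by positivity
  rw [div_le_iff₀ h2m] at ht₁
  rw [le_div_iff₀ h2m] at ht₂
  have hs₁ : (l * 2 ^ d : ℝ) ≤ t * 2 ^ (m + d) := by
    rw [pow_add, ← mul_assoc]; gcongr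
  have hs₂ : t * 2 ^ (m + d) ≤ (l + 1) * 2 ^ d := by
    rw [pow_add, ← mul_assoc]; gcongr
  have hs₀ : 0 ≤ t * 2 ^ (m + d) := le_trans (by positivity) hs₁
  have h2d' : 0 < 2 ^ d := by positivity
  obtain ⟨k, hk₁, hk₂, hk₃, hk₄⟩ : ∃ k : ℕ, l * 2 ^ d ≤ k ∧ k + 1 ≤ (l + 1) * 2 ^ d ∧
      (k : ℝ) ≤ t * 2 ^ (m + d) ∧ t * 2 ^ (m + d) ≤ k + 1 := by
    rcases hs₂.lt_or_eq with h | h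
    · refine ⟨⌊t * 2 ^ (m + d)⌋₊, Nat.le_floor (by exact_mod_cast hs₁), ?_, Nat.floor_le hs₀,
        (Nat.lt_floor_add_one _).le⟩
      exact (Nat.floor_lt hs₀).2 (by exact_mod_cast h)
    -- At the right endpoint the floor would select a leaf outside the interval, so its last leaf is
    -- taken.
    · refine ⟨(l + 1) * 2 ^ d - 1, ?_, ?_, ?_, ?_⟩
      · rw [add_mul]; omega
      · rw [Nat.sub_add_cancel (by rw [add_mul]; omega)]
      · rw [h, Nat.cast_sub (by rw [add_mul]; omega)]
        push_cast
        linarith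
      · rw [h, Nat.cast_sub (by rw [add_mul]; omega)]
        push_cast
        linarith
  have hkN : k < 2 ^ (m + d) := by
    have : (l + 1) * 2 ^ d ≤ 2 ^ m * 2 ^ d := Nat.mul_le_mul_right _ hl
    rw [pow_add]
    omega
  have hk₁' : (l * 2 ^ d : ℝ) ≤ k := by exact_mod_cast hk₁
  have hk₂' : (k + 1 : ℝ) ≤ (l + 1) * 2 ^ d := by exact_mod_cast hk₂
  refine ⟨⟨k, hkN⟩, Set.Icc_subset_Icc ?_ ?_, ?_, ?_⟩ <;>
    simp only [leafNode, Fin.val_last]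
  · rw [div_le_div_iff₀ h2m h2n, pow_add, ← mul_assoc, mul_right_comm]
    gcongr
  · rw [div_le_div_iff₀ h2n h2m, pow_add, ← mul_assoc, mul_right_comm _ (2 ^ m)]
    gcongr
  · rwa [div_le_iff₀ h2n]
  · rwa [le_div_iff₀ h2n]

theorem rect_subset_iff {α β : BiTree N} : rect α ⊆ rect β ↔ α.1 ≤ β.1 ∧ α.2 ≤ β.2 := by
  rw [rect, rect, Set.prod_subset_prod_iff, Tree.le_iff, Tree.le_iff, or_iff_left]
  simp [α.1.interval_nonempty.ne_empty, α.2.interval_nonempty.ne_empty]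

theorem rect_leaf_subset_iff {ω : Boundary N} {β : BiTree N} :
    rect (leaf ω) ⊆ rect β ↔ leafNode ω.1 ≤ β.1 ∧ leafNode ω.2 ≤ β.2 :=
  rect_subset_iff

theorem rectMass_eq_shadow (μ : Boundary N → ℝ) (α : BiTree N) :
    rectMass μ α = shadow leafNode μ α.1 α.2 := by
  classical
  simp only [rectMass, shadow, Finset.sum_filter, rect_leaf_subset_iff]

theorem potential_eq_hardy (μ : Boundary N → ℝ) (α : BiTree N) :
    potential μ α = hardy (shadow leafNode μ) α.1 α.2 := by
  classical
  simp only [potential, hardy, rect_subset_iff, rectMass_eq_shadow, Finset.sum_filter,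
    Fintype.sum_prod_type]
  refine Finset.sum_congr rfl fun a _ => ?_
  by_cases h : α.1 ≤ a <;> simp [h]

theorem rect_subset_squareUnion {E : Finset (Boundary N)} {α : BiTree N}
    (h : ∀ ω, rect (leaf ω) ⊆ rect α → ω ∈ E) : rect α ⊆ squareUnion E := by
  rintro ⟨s, t⟩ ⟨hs, ht⟩
  obtain ⟨i, hi, hsi⟩ := α.1.exists_leafNode hs
  obtain ⟨j, hj, htj⟩ := α.2.exists_leafNode ht
  exact Set.mem_biUnion (x := (i, j)) (h (i, j) (rect_leaf_subset_iff.2 ⟨hi, hj⟩)) ⟨hsi, htj⟩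

end Dyadic

/-! ### Splitting the energy by the size of the potential. -/

section Energy

variable {N : ℕ}

theorem rectMass_nonneg {μ : Boundary N → ℝ} (hμ : ∀ ω, 0 ≤ μ ω) (α : BiTree N) :
    0 ≤ rectMass μ α :=
  Finset.sum_nonneg fun ω _ => hμ ω

theorem rectMass_mono {μ ν : Boundary N → ℝ} (h : ∀ ω, μ ω ≤ ν ω) (α : BiTree N) :
    rectMass μ α ≤ rectMass ν α :=
  Finset.sum_le_sum fun ω _ => h ω

theorem potential_anti {μ : Boundary N → ℝ} (hμ : ∀ ω, 0 ≤ μ ω) {α β : BiTree N}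
    (h : rect α ⊆ rect β) : potential μ β ≤ potential μ α := by
  classical
  refine Finset.sum_le_sum_of_subset_of_nonneg (fun γ hγ => ?_) fun γ _ _ => rectMass_nonneg hμ γ
  simp only [Finset.mem_filter, Finset.mem_univ, true_and] at hγ ⊢
  exact h.trans hγ

theorem restrict_nonneg {μ : Boundary N → ℝ} (hμ : ∀ ω, 0 ≤ μ ω) (E : Finset (Boundary N))
    (ω : Boundary N) : 0 ≤ restrict μ E ω := by
  unfold restrict; split_ifs <;> simp [hμ]

theorem restrict_le {μ : Boundary N → ℝ} (hμ : ∀ ω, 0 ≤ μ ω) (E : Finset (Boundary N))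
    (ω : Boundary N) : restrict μ E ω ≤ μ ω := by
  unfold restrict; split_ifs <;> simp [hμ]

theorem sum_mul_restrict (μ h : Boundary N → ℝ) (E : Finset (Boundary N)) :
    ∑ ω, h ω * restrict μ E ω = ∑ ω ∈ E, h ω * μ ω := by
  simp [restrict]

theorem sum_restrict (μ : Boundary N → ℝ) (E : Finset (Boundary N)) :
    ∑ ω, restrict μ E ω = massOf μ E := by
  simp [restrict, massOf]

theorem massOf_nonneg {μ : Boundary N → ℝ} (hμ : ∀ ω, 0 ≤ μ ω) (E : Finset (Boundary N)) :
    0 ≤ massOf μ E :=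
  Finset.sum_nonneg fun ω _ => hμ ω

theorem energy_nonneg (μ : Boundary N → ℝ) : 0 ≤ energy μ := by
  rw [energy_eq_sum_sq]
  exact Finset.sum_nonneg fun α _ => sq_nonneg _

theorem energy_restrict_eq_zero {μ : Boundary N → ℝ} (hμ : ∀ ω, 0 ≤ μ ω)
    {E : Finset (Boundary N)} (hE : massOf μ E = 0) : energy (restrict μ E) = 0 := by
  rw [massOf, Finset.sum_eq_zero_iff_of_nonneg fun ω _ => hμ ω] at hE
  rw [energy, sum_mul_restrict]
  exact Finset.sum_eq_zero fun ω hω => by rw [hE ω hω, mul_zero]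

/-- The mutual energy inequality. -/
theorem sq_sum_potential_mul_le (μ ρ : Boundary N → ℝ) :
    (∑ ω, potential μ (leaf ω) * ρ ω) ^ 2 ≤ energy μ * energy ρ := by
  have h : ∑ ω, potential μ (leaf ω) * ρ ω = ∑ α, rectMass μ α * rectMass ρ α := by
    simp only [potential_eq_hardy, rectMass_eq_shadow, Fintype.sum_prod_type (α₁ := Tree N)]
    exact sum_hardy_mul leafNode ρ _
  rw [h, energy_eq_sum_sq, energy_eq_sum_sq]
  exact Finset.sum_mul_sq_le_sq_mul_sq _ _ _

open Classical in
/-- The energy carried by the rectangles of small potential. -/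
theorem sum_sq_rectMass_low_le {ν : Boundary N → ℝ} (hν : ∀ ω, 0 ≤ ν ω) {δ lam : ℝ} (hδ : 0 ≤ δ)
    (hlam : 0 < lam) (hδlam : 4 * δ ≤ lam) :
    ∑ α with potential ν α ≤ δ, rectMass ν α ^ 2
      ≤ lam * ∑ ω, ν ω + 8 * (δ / lam) * energy ν := by
  have key := sum_lowPart_mul_le Tree.chainAncestors (ℓ := leafNode) hν hδ hlam hδlam
  simp only [energy_eq_sum_sq, potential_eq_hardy, rectMass_eq_shadow, Finset.sum_filter,
    Fintype.sum_prod_type (α₁ := Tree N)]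
  refine le_trans (Finset.sum_le_sum fun a _ => Finset.sum_le_sum fun b _ => ?_) key
  unfold lowPart
  split_ifs <;> simp [sq]

open Classical in
/-- The leaves at which the potential of `ν` exceeds `δ`. -/
noncomputable def highLeaves (ν : Boundary N → ℝ) (δ : ℝ) : Finset (Boundary N) :=
  Finset.univ.filter fun ω => δ < potential ν (leaf ω)

open Classical in
/-- The energy of `ν ≤ μ` carried by the rectangles of large potential, under the Carleson
condition for `μ`. -/
theorem sum_sq_rectMass_high_le {μ ν : Boundary N → ℝ} {K : ℝ} (hK : IsCarleson K μ)
    (hν : ∀ ω, 0 ≤ ν ω) (hνμ : ∀ ω, ν ω ≤ μ ω) (δ : ℝ) :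
    ∑ α with ¬ potential ν α ≤ δ, rectMass ν α ^ 2 ≤ K * massOf μ (highLeaves ν δ) := by
  refine le_trans ?_ (hK (highLeaves ν δ))
  refine (Finset.sum_le_sum fun α _ => pow_le_pow_left₀ (rectMass_nonneg hν α)
    (rectMass_mono hνμ α) 2).trans ?_
  refine Finset.sum_le_sum_of_subset_of_nonneg (fun α hα => ?_) fun α _ _ => sq_nonneg _
  simp only [rectsIn, Finset.mem_filter, Finset.mem_univ, true_and, not_le] at hα ⊢
  refine rect_subset_squareUnion fun ω hω => ?_
  simp only [highLeaves, Finset.mem_filter, Finset.mem_univ, true_and]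
  exact hα.trans_le (potential_anti hν hω)

/-- A weak-type bound for the leaves of large potential under the restricted energy condition. -/
theorem sq_mul_massOf_highLeaves_le {μ ν : Boundary N → ℝ} (hμ : ∀ ω, 0 ≤ μ ω) {R : ℝ}
    (hR0 : 0 ≤ R) (hR : IsREC R μ) {δ : ℝ} (hδ : 0 ≤ δ) :
    δ ^ 2 * massOf μ (highLeaves ν δ) ≤ R * energy ν := by
  set F := highLeaves ν δ with hF
  -- Chebyshev on `F`; the mutual energy inequality then yields `δ² μ(F)² ≤ 𝓔[ν] R μ(F)`, and one
  -- factor `μ(F)` cancels.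
  have h1 : δ * massOf μ F ≤ ∑ ω, potential ν (leaf ω) * restrict μ F ω := by
    rw [sum_mul_restrict, massOf, Finset.mul_sum]
    refine Finset.sum_le_sum fun ω hω => mul_le_mul_of_nonneg_right ?_ (hμ ω)
    simp only [hF, highLeaves, Finset.mem_filter, Finset.mem_univ, true_and] at hω
    exact hω.le
  have hF0 := massOf_nonneg hμ F
  have h2 := (pow_le_pow_left₀ (mul_nonneg hδ hF0) h1 2).trans (sq_sum_potential_mul_le _ _)
  have h3 := mul_le_mul_of_nonneg_left (hR F) (energy_nonneg ν)
  rcases hF0.eq_or_lt with h0 | h0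
  · rw [← h0, mul_zero]
    exact mul_nonneg hR0 (energy_nonneg ν)
  · refine le_of_mul_le_mul_right ?_ h0
    nlinarith

/-- The restricted energy condition improves as soon as it is sharp for some set. -/
theorem le_mul_of_energy_eq {μ : Boundary N → ℝ} (hμ : ∀ ω, 0 ≤ μ ω) {K R : ℝ} (hK0 : 0 ≤ K)
    (hK : IsCarleson K μ) (hR0 : 0 < R) (hR : IsREC R μ) {E : Finset (Boundary N)}
    (hE : 0 < massOf μ E) (hER : energy (restrict μ E) = R * massOf μ E) :
    R ≤ 32768 * K := by
  classical
  have hν := restrict_nonneg hμ E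
  -- With these parameters both `lam` and `8 (δ / lam) R` equal `R / 4`, so the low part is at most
  -- `R μ(E) / 2`.
  have hlow := sum_sq_rectMass_low_le hν (δ := R / 128) (lam := R / 4) (by positivity)
    (by positivity) (by linarith)
  have hhigh := sum_sq_rectMass_high_le hK hν (restrict_le hμ E) (R / 128)
  have hweak := sq_mul_massOf_highLeaves_le (ν := restrict μ E) hμ hR0.le hR (δ := R / 128)
    (by positivity)
  have hsplit := Finset.sum_filter_add_sum_filter_not Finset.univ
    (fun α => potential (restrict μ E) α ≤ R / 128) (fun α => rectMass (restrict μ E) α ^ 2)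
  rw [← energy_eq_sum_sq, hER] at hsplit
  rw [sum_restrict, hER, show R / 128 / (R / 4) = 1 / 32 by field_simp; norm_num] at hlow
  rw [hER] at hweak
  have hF : massOf μ (highLeaves (restrict μ E) (R / 128)) ≤ 16384 * massOf μ E := by
    have : 0 < R ^ 2 := by positivity
    refine le_of_mul_le_mul_left ?_ this
    linarith
  have hKF := mul_le_mul_of_nonneg_left hF hK0
  refine le_of_mul_le_mul_right ?_ hE
  linarith

end Energy

end BiParameter

theorem theorem1p5 :
    ∃ C : ℝ, 0 < C ∧
      ∀ (N : ℕ) (μ : BiParameter.Boundary N → ℝ), (∀ ω, 0 ≤ μ ω) →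
        ∀ K : ℝ, 0 ≤ K →
          BiParameter.IsCarleson K μ → BiParameter.IsREC (C * K) μ := by
  refine ⟨32768, by norm_num, fun N μ hμ K hK0 hK => ?_⟩
  -- There are finitely many sets. Null sets get ratio `0` by division by zero, consistent with
  -- their zero energy.
  obtain ⟨E, hE⟩ := Finite.exists_max fun E : Finset (BiParameter.Boundary N) =>
    BiParameter.energy (BiParameter.restrict μ E) / BiParameter.massOf μ E
  set R := BiParameter.energy (BiParameter.restrict μ E) / BiParameter.massOf μ E with hRdef
  have hREC : BiParameter.IsREC R μ := by
    intro F
    rcases (BiParameter.massOf_nonneg hμ F).eq_or_lt with h | h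
    · rw [BiParameter.energy_restrict_eq_zero hμ h.symm, ← h, mul_zero]
    · exact (div_le_iff₀ h).1 (hE F)
  have hR : R ≤ 32768 * K := by
    rcases le_or_gt R 0 with h | h
    · exact h.trans (by positivity)
    · have hm : 0 < BiParameter.massOf μ E := by
        refine (BiParameter.massOf_nonneg hμ E).lt_of_ne fun h0 => ?_
        rw [hRdef, ← h0, div_zero] at h
        exact h.false
      exact BiParameter.le_mul_of_energy_eq hμ hK0 hK h hREC hm (div_mul_cancel₀ _ hm.ne').symm
  exact fun F => (hREC F).trans
    (mul_le_mul_of_nonneg_right hR (BiParameter.massOf_nonneg hμ F))
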